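/- Let $n\ge 0$ and $p\ge 2$ be integers, let $\mathcal A:\mathbb R^n\to\mathbb R^{p\times p}$ be a linear map and $x_o\in\mathbb R^n$. For a matrix $X\in\mathbb R^{p\times p}$ let $\sigma(X)=(\sigma_1(X),\dots,\sigma_p(X))$ be its singular values in nonincreasing order, $\|X\|_*=\sum_{i=1}^p\sigma_i(X)$ its nuclear norm and $\|X\|_F$ its Frobenius norm. For $\lambda\ge 0$ consider the problem $$\text{minimize } \|\mathcal A(x)\|_*\quad\text{over } x\in\mathbb R^n \quad\text{subject to } \|x-x_o\|_2\le\lambda. \qquad (P_\lambda)$$ There is a constant $C\ge 0$, depending only on $\mathcal A$, such that $$\|\mathcal A(x)\|_F^2\le C\|x\|_2^2\quad\text{for all }x\in\mathbb R^n.$$ Let $C_{\mathcal A}\ge 0$ be any such constant, let $0\le\lambda^\star\le\lambda$, let $x_{\lambda^\star}$ and $x_\lambda$ be any optimal solutions of $(P_{\lambda^\star})$ and $(P_\lambda)$, respectively, and write $\sigma^{\lambda^\star}=\sigma(\mathcal A(x_{\lambda^\star}))$ and $\sigma^{\lambda}=\sigma(\mathcal A(x_{\lambda}))$. Let $i^{\min}\in\{1,\dots,p\}$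 be any index that minimizes $\sigma_i^{\lambda^\star}$, and let $e_{i^{\min}}$ be the corresponding standard unit vector of $\mathbb R^p$. Then $$\sum_{i=1}^p\left(\sigma_i^{\lambda^\star}-\sigma_i^{\lambda}\right)^2\ \le\ \min\left\{\left\|\sigma^{\lambda^\star}-\|\mathcal A(x_{\lambda^\star})\|_*\,e_{i^{\min}}\right\|_2^2,\ C_{\mathcal A}\left(\lambda^2-(\lambda^\star)^2\right)\right\}.$$ -/

import Mathlib

/-- The vector of singular values `(σ₁, …, σ_p)` of a real `p × p` matrix, listed in
nonincreasing order and with multiplicity (zeros included). -/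
noncomputable def singularVector {p : ℕ} (M : Matrix (Fin p) (Fin p) ℝ) :
    EuclideanSpace ℝ (Fin p) :=
  WithLp.toLp 2 fun i => (Matrix.toEuclideanLin M).singularValues (i : ℕ)

/-- The nuclear norm of a square matrix: the sum of its singular values. -/
noncomputable def nuclearNorm {p : ℕ} (M : Matrix (Fin p) (Fin p) ℝ) : ℝ :=
  ∑ i, singularVector M i

/-- `x` is an optimal solution of: minimize `‖A y‖_*` over `y`, subject to `‖y - xo‖₂ ≤ lam`. -/
def IsOptimalSolution {n p : ℕ}
    (A : EuclideanSpace ℝ (Fin n) →ₗ[ℝ] Matrix (Fin p) (Fin p) ℝ)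
    (xo : EuclideanSpace ℝ (Fin n)) (lam : ℝ) (x : EuclideanSpace ℝ (Fin n)) : Prop :=
  ‖x - xo‖ ≤ lam ∧
    ∀ y : EuclideanSpace ℝ (Fin n), ‖y - xo‖ ≤ lam → nuclearNorm (A x) ≤ nuclearNorm (A y)

section Frobenius

attribute [local instance] Matrix.frobeniusNormedAddCommGroup

/-- The Frobenius norm of a square matrix. -/
noncomputable def frobeniusNorm {p : ℕ} (M : Matrix (Fin p) (Fin p) ℝ) : ℝ := ‖M‖

end Frobenius

/-- `C` is an admissible constant for the linear map `A`: it is nonnegative and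
`‖A x‖_F² ≤ C ‖x‖₂²` for all `x`. (Nonnegativity is automatic unless `n = 0`.) -/
def IsNormEquivConst {n p : ℕ}
    (A : EuclideanSpace ℝ (Fin n) →ₗ[ℝ] Matrix (Fin p) (Fin p) ℝ) (C : ℝ) : Prop :=
  0 ≤ C ∧ ∀ x : EuclideanSpace ℝ (Fin n), frobeniusNorm (A x) ^ 2 ≤ C * ‖x‖ ^ 2

open Finset Module

/-! The first bound uses only that both vectors are nonnegative and that the larger ball has the
smaller optimal value. For the second, Mirsky's inequality `LinearMap.sum_sq_singularValues_sub_le`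
(via von Neumann's trace inequality) bounds the left side by `‖A (xStar - xLam)‖_F²`, hence by `CA *
‖xStar - xLam‖²`. If the optimal value at `xStar` is positive, `xStar` is the projection of `xo`
onto the convex sublevel set of the objective through `xStar`, at distance exactly `lamStar`. As
`xLam` lies in that set, the obtuse-angle property of projections
(`IsOptimalSolution.norm_sub_sq_le`) gives `‖xStar - xLam‖² ≤ lam² - lamStar²`. -/

/-- The bilinear form of a doubly stochastic matrix at two antitone vectors is at most their dot
product. -/
theorem sum_mul_le_of_mem_doublyStochastic {p : ℕ} {D : Matrix (Fin p) (Fin p) ℝ}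
    (hD : D ∈ doublyStochastic ℝ (Fin p)) {f g : Fin p → ℝ} (hf : Antitone f) (hg : Antitone g) :
    ∑ i, ∑ j, f i * g j * D i j ≤ ∑ i, f i * g i := by
  -- Birkhoff's theorem reduces to permutation matrices, where this is the rearrangement inequality.
  obtain ⟨w, hw0, hw1, rfl⟩ := exists_eq_sum_perm_of_mem_doublyStochastic hD
  calc ∑ i, ∑ j, f i * g j * (∑ s : Equiv.Perm (Fin p), w s • s.permMatrix ℝ) i j
      = ∑ s : Equiv.Perm (Fin p), w s * ∑ i, f i * g (s i) := by
        simp only [Matrix.sum_apply, Matrix.smul_apply, Equiv.Perm.permMatrix,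
          PEquiv.toMatrix_apply, Equiv.toPEquiv_apply, Option.mem_def, Option.some.injEq,
          smul_eq_mul, mul_sum]
        rw [sum_congr rfl fun i _ => sum_comm, sum_comm]
        refine sum_congr rfl fun s _ => sum_congr rfl fun i _ => ?_
        simp [mul_comm]
    _ ≤ ∑ s : Equiv.Perm (Fin p), w s * ∑ i, f i * g i := by
        exact sum_le_sum fun s _ => mul_le_mul_of_nonneg_left
          (hf.monovary hg).sum_mul_comp_perm_le_sum_mul (hw0 s)
    _ = ∑ i, f i * g i := by rw [← sum_mul, hw1, one_mul]

/-- The squared inner products between two orthonormal bases form a doubly stochastic matrix. -/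
theorem sq_inner_mem_doublyStochastic {p : ℕ} {E : Type*} [NormedAddCommGroup E]
    [InnerProductSpace ℝ E] (b c : OrthonormalBasis (Fin p) ℝ E) :
    (Matrix.of fun i j => inner ℝ (b i) (c j) ^ 2) ∈ doublyStochastic ℝ (Fin p) := by
  rw [mem_doublyStochastic_iff_sum]
  refine ⟨fun i j => sq_nonneg _, fun i => ?_, fun j => ?_⟩
  · simpa using c.sum_sq_norm_inner_left (b i)
  · simpa using b.sum_sq_norm_inner_right (c j)

/-! ### Singular values of linear maps: decomposition, trace inequality, perturbation. -/

section InnerProductSpace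

variable {p : ℕ} {E F : Type*} [NormedAddCommGroup E] [InnerProductSpace ℝ E]
  [FiniteDimensional ℝ E] [NormedAddCommGroup F] [InnerProductSpace ℝ F] [FiniteDimensional ℝ F]

/-- Singular value decomposition of a linear map between spaces of the same dimension. -/
theorem LinearMap.exists_singularValueDecomposition (hE : finrank ℝ E = p) (hF : finrank ℝ F = p)
    (T : E →ₗ[ℝ] F) :
    ∃ (u : OrthonormalBasis (Fin p) ℝ F) (v : OrthonormalBasis (Fin p) ℝ E),
      ∀ i : Fin p, T (v i) = T.singularValues i • u i := by
  let v := T.isSymmetric_adjoint_comp_self.eigenvectorBasis hE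
  have hinner (i j) : inner ℝ (T (v i)) (T (v j)) =
      if i = j then T.singularValues i ^ 2 else 0 := by
    rw [← LinearMap.adjoint_inner_right, ← LinearMap.comp_apply,
      T.isSymmetric_adjoint_comp_self.apply_eigenvectorBasis hE j, inner_smul_right,
      orthonormal_iff_ite.mp v.orthonormal i j, T.sq_singularValues_fin hE]
    split_ifs with h <;> simp [h]
  let s : Set (Fin p) := {i | T.singularValues i ≠ 0}
  let w : Fin p → F := fun i => (T.singularValues i)⁻¹ • T (v i)
  -- Only nonzero singular values determine left singular vectors; the rest of `u` is an arbitrary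
  -- orthonormal completion.
  have hw : Orthonormal ℝ (s.domRestrict w) := by
    rw [orthonormal_iff_ite]
    rintro ⟨i, hi⟩ ⟨j, hj⟩
    have hi' : T.singularValues i ≠ 0 := hi
    simp only [Set.domRestrict_apply, w, inner_smul_left, inner_smul_right, hinner,
      Subtype.mk.injEq]
    split_ifs with h
    · subst h
      simp
      field_simp
    · simp
  obtain ⟨u, hu⟩ := hw.exists_orthonormalBasis_extension_of_card_eq (by simpa using hF)
  refine ⟨u, v, fun i => ?_⟩
  by_cases hi : T.singularValues i = 0
  · rw [hi, zero_smul, ← inner_self_eq_zero (𝕜 := ℝ), hinner, if_pos rfl, hi]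
    norm_num
  · rw [hu i hi, smul_smul, mul_inv_cancel₀ hi, one_smul]

/-- **Von Neumann's trace inequality**, for a matrix given by its singular value decomposition. -/
theorem LinearMap.sum_mul_inner_le_sum_mul_singularValues (T : E →ₗ[ℝ] F)
    (u : OrthonormalBasis (Fin p) ℝ F) (v : OrthonormalBasis (Fin p) ℝ E) {f : Fin p → ℝ}
    (hf : Antitone f) (hf0 : ∀ i, 0 ≤ f i) :
    ∑ i, f i * inner ℝ (u i) (T (v i)) ≤ ∑ i, f i * T.singularValues (i : ℕ) := by
  obtain ⟨u', v', h⟩ := T.exists_singularValueDecomposition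
    (by simpa using finrank_eq_card_basis v.toBasis)
    (by simpa using finrank_eq_card_basis u.toBasis)
  set s : Fin p → ℝ := fun i => T.singularValues (i : ℕ) with hs
  have hsanti : Antitone s := fun i j hij => T.singularValues_antitone hij
  have hexp (i) : inner ℝ (u i) (T (v i)) =
      ∑ j, s j * (inner ℝ (v i) (v' j) * inner ℝ (u i) (u' j)) := by
    conv_lhs => rw [← v'.sum_repr' (v i)]
    simp only [map_sum, map_smul, h, inner_sum, inner_smul_right]
    refine sum_congr rfl fun j _ => ?_
    rw [real_inner_comm (v i) (v' j)]
    ring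
  have hv := sum_mul_le_of_mem_doublyStochastic (sq_inner_mem_doublyStochastic v v') hf hsanti
  have hu := sum_mul_le_of_mem_doublyStochastic (sq_inner_mem_doublyStochastic u u') hf hsanti
  simp only [Matrix.of_apply] at hu hv
  have key : ∑ i, f i * inner ℝ (u i) (T (v i)) ≤
      ∑ i, ∑ j, (f i * s j * inner ℝ (v i) (v' j) ^ 2 / 2 +
        f i * s j * inner ℝ (u i) (u' j) ^ 2 / 2) := by
    refine sum_le_sum fun i _ => ?_
    rw [hexp, mul_sum]
    refine sum_le_sum fun j _ => ?_
    -- `2ab ≤ a² + b²` replaces the product of inner products by two doubly stochastic matrices.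
    have := mul_nonneg (mul_nonneg (hf0 i) (T.singularValues_nonneg j))
      (sq_nonneg (inner ℝ (v i) (v' j) - inner ℝ (u i) (u' j)))
    simp only [hs]
    linarith
  simp only [sum_add_distrib, ← sum_div] at key
  linarith

/-- The Hilbert–Schmidt norm does not depend on the orthonormal basis. -/
theorem LinearMap.sum_norm_sq_apply_eq (T : E →ₗ[ℝ] F) (b c : OrthonormalBasis (Fin p) ℝ E) :
    ∑ i, ‖T (b i)‖ ^ 2 = ∑ i, ‖T (c i)‖ ^ 2 := by
  have h (b : OrthonormalBasis (Fin p) ℝ E) :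
      ∑ i, ‖T (b i)‖ ^ 2 = LinearMap.trace ℝ E (T.adjoint ∘ₗ T) := by
    rw [LinearMap.trace_eq_sum_inner _ b]
    simp [LinearMap.adjoint_inner_right]
  rw [h, h]

/-- **Mirsky's inequality** for the Hilbert–Schmidt norm. -/
theorem LinearMap.sum_sq_singularValues_sub_le (hF : finrank ℝ F = p) (S T : E →ₗ[ℝ] F)
    (b : OrthonormalBasis (Fin p) ℝ E) :
    ∑ i : Fin p, (S.singularValues i - T.singularValues i) ^ 2 ≤ ∑ i, ‖(S - T) (b i)‖ ^ 2 := by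
  have hE : finrank ℝ E = p := by simpa using finrank_eq_card_basis b.toBasis
  have hnorm (R : E →ₗ[ℝ] F) : ∑ i, ‖R (b i)‖ ^ 2 = ∑ i : Fin p, R.singularValues i ^ 2 := by
    obtain ⟨u, v, h⟩ := R.exists_singularValueDecomposition hE hF
    rw [R.sum_norm_sq_apply_eq b v]
    simp [h, norm_smul]
  obtain ⟨u, v, h⟩ := S.exists_singularValueDecomposition hE hF
  have hcross := T.sum_mul_inner_le_sum_mul_singularValues u v
    (f := fun i => S.singularValues (i : ℕ)) (fun i j hij => S.singularValues_antitone hij)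
    (fun i => S.singularValues_nonneg i)
  have hS := hnorm S
  have hT := hnorm T
  rw [LinearMap.sum_norm_sq_apply_eq _ b v] at hS hT
  rw [LinearMap.sum_norm_sq_apply_eq _ b v]
  simp only [LinearMap.sub_apply, norm_sub_sq_real, sub_sq, sum_add_distrib, sum_sub_distrib, hS,
    hT, mul_assoc, ← mul_sum]
  have : ∑ i, inner ℝ (S (v i)) (T (v i)) =
      ∑ i : Fin p, S.singularValues i * inner ℝ (u i) (T (v i)) := by
    simp [h, inner_smul_left]
  rw [this]
  linarith

end InnerProductSpace

/-! ### Nuclear and Frobenius norms of matrices. -/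

section Matrix

variable {p : ℕ}

theorem singularVector_nonneg (M : Matrix (Fin p) (Fin p) ℝ) (i : Fin p) :
    0 ≤ singularVector M i :=
  LinearMap.singularValues_nonneg _ _

theorem nuclearNorm_nonneg (M : Matrix (Fin p) (Fin p) ℝ) : 0 ≤ nuclearNorm M :=
  sum_nonneg fun i _ => singularVector_nonneg M i

/-- The nuclear norm is attained as a sum of inner products along two orthonormal bases. -/
theorem exists_nuclearNorm_eq_sum_inner (M : Matrix (Fin p) (Fin p) ℝ) :
    ∃ u v : OrthonormalBasis (Fin p) ℝ (EuclideanSpace ℝ (Fin p)),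
      nuclearNorm M = ∑ i, inner ℝ (u i) (Matrix.toEuclideanLin M (v i)) := by
  obtain ⟨u, v, h⟩ := (Matrix.toEuclideanLin M).exists_singularValueDecomposition
    (p := p) (by simp) (by simp)
  exact ⟨u, v, by simp [nuclearNorm, singularVector, h, inner_smul_right]⟩

theorem sum_inner_le_nuclearNorm (M : Matrix (Fin p) (Fin p) ℝ)
    (u v : OrthonormalBasis (Fin p) ℝ (EuclideanSpace ℝ (Fin p))) :
    ∑ i, inner ℝ (u i) (Matrix.toEuclideanLin M (v i)) ≤ nuclearNorm M := by
  simpa [nuclearNorm, singularVector] using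
    (Matrix.toEuclideanLin M).sum_mul_inner_le_sum_mul_singularValues u v (f := fun _ => 1)
      antitone_const (fun _ => zero_le_one)

/-- The nuclear norm is a maximum of functionals linear in the matrix, one for each pair of
orthonormal bases. -/
theorem nuclearNorm_add_le (M N : Matrix (Fin p) (Fin p) ℝ) :
    nuclearNorm (M + N) ≤ nuclearNorm M + nuclearNorm N := by
  obtain ⟨u, v, h⟩ := exists_nuclearNorm_eq_sum_inner (M + N)
  rw [h]
  simp only [map_add, LinearMap.add_apply, inner_add_right, sum_add_distrib]
  exact add_le_add (sum_inner_le_nuclearNorm M u v) (sum_inner_le_nuclearNorm N u v)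

theorem nuclearNorm_smul_le {c : ℝ} (hc : 0 ≤ c) (M : Matrix (Fin p) (Fin p) ℝ) :
    nuclearNorm (c • M) ≤ c * nuclearNorm M := by
  obtain ⟨u, v, h⟩ := exists_nuclearNorm_eq_sum_inner (c • M)
  rw [h]
  simp only [map_smul, LinearMap.smul_apply, inner_smul_right, ← mul_sum]
  exact mul_le_mul_of_nonneg_left (sum_inner_le_nuclearNorm M u v) hc

theorem frobeniusNorm_sq (M : Matrix (Fin p) (Fin p) ℝ) :
    frobeniusNorm M ^ 2 =
      ∑ j, ‖Matrix.toEuclideanLin M (EuclideanSpace.basisFun (Fin p) ℝ j)‖ ^ 2 := by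
  rw [frobeniusNorm, Matrix.frobenius_norm_def, ← Real.sqrt_eq_rpow,
    Real.sq_sqrt (by positivity), sum_comm]
  simp [EuclideanSpace.norm_sq_eq, Matrix.toLpLin_apply]

theorem sum_sq_singularVector_sub_le (M N : Matrix (Fin p) (Fin p) ℝ) :
    ∑ i, (singularVector M i - singularVector N i) ^ 2 ≤ frobeniusNorm (M - N) ^ 2 := by
  rw [frobeniusNorm_sq, map_sub]
  exact LinearMap.sum_sq_singularValues_sub_le (by simp) _ _ _

/-- A vector with nonnegative entries whose sum is at most `∑ i, a i` is no farther from the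
nonnegative vector `a` than the vertex of that simplex at a smallest entry of `a`. -/
theorem sum_sq_sub_le_norm_sub_single_sq (hp : 2 ≤ p) {a b : EuclideanSpace ℝ (Fin p)}
    (ha : ∀ i, 0 ≤ a i) (hb : ∀ i, 0 ≤ b i) (hab : ∑ i, b i ≤ ∑ i, a i) {m : Fin p}
    (hm : ∀ i, a m ≤ a i) :
    ∑ i, (a i - b i) ^ 2 ≤
      ‖a - (∑ i, a i) • EuclideanSpace.single m (1 : ℝ)‖ ^ 2 := by
  have h2 : 2 * a m ≤ ∑ i, a i := by
    have h := card_nsmul_le_sum univ (fun i => a i) (a m) (fun i _ => hm i)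
    rw [card_univ, Fintype.card_fin, nsmul_eq_mul] at h
    have hp' : (2 : ℝ) ≤ p := by exact_mod_cast hp
    nlinarith [ha m]
  have hcross : a m * ∑ i, b i ≤ ∑ i, a i * b i := by
    rw [mul_sum]
    exact sum_le_sum fun i _ => mul_le_mul_of_nonneg_right (hm i) (hb i)
  have hsq : ∑ i, b i ^ 2 ≤ (∑ i, b i) ^ 2 := sum_sq_le_sq_sum_of_nonneg fun i _ => hb i
  have hb0 : 0 ≤ ∑ i, b i := sum_nonneg fun i _ => hb i
  rw [norm_sub_sq_real, inner_smul_right, norm_smul, EuclideanSpace.inner_single_right,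
    EuclideanSpace.norm_sq_eq]
  simp only [sub_sq, sum_add_distrib, sum_sub_distrib, mul_assoc, ← mul_sum, Real.norm_eq_abs,
    sq_abs, PiLp.norm_single, conj_trivial, one_mul, abs_one, mul_one]
  -- With `S = ∑ a i` and `s = ∑ b i`, the gap is at least `(S - s) * (S + s - 2 * a m)`; `h2`,
  -- hence `2 ≤ p`, makes the second factor nonnegative.
  nlinarith [mul_nonneg (sub_nonneg.mpr hab) (show 0 ≤ ∑ i, a i + ∑ i, b i - 2 * a m by linarith)]

theorem exists_isNormEquivConst {n : ℕ}
    (A : EuclideanSpace ℝ (Fin n) →ₗ[ℝ] Matrix (Fin p) (Fin p) ℝ) :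
    ∃ C : ℝ, IsNormEquivConst A C := by
  let B (j : Fin p) := LinearMap.toContinuousLinearMap
    (LinearMap.applyₗ (EuclideanSpace.basisFun (Fin p) ℝ j) ∘ₗ
      (Matrix.toEuclideanLin (𝕜 := ℝ) (m := Fin p) (n := Fin p)).toLinearMap ∘ₗ A)
  refine ⟨∑ j, ‖B j‖ ^ 2, by positivity, fun x => ?_⟩
  rw [frobeniusNorm_sq, sum_mul]
  refine sum_le_sum fun j _ => ?_
  rw [← mul_pow]
  exact pow_le_pow_left₀ (norm_nonneg _) ((B j).le_opNorm x) 2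

end Matrix

/-! ### Geometry of optimal solutions. -/

section Optimality

variable {n p : ℕ} {A : EuclideanSpace ℝ (Fin n) →ₗ[ℝ] Matrix (Fin p) (Fin p) ℝ}
  {xo x : EuclideanSpace ℝ (Fin n)} {lam : ℝ}

/-- If the optimal value is positive, no point of the open ball is optimal. -/
theorem IsOptimalSolution.le_norm_sub (hx : IsOptimalSolution A xo lam x)
    (hpos : 0 < nuclearNorm (A x)) {y : EuclideanSpace ℝ (Fin n)}
    (hy : nuclearNorm (A y) ≤ nuclearNorm (A x)) : lam ≤ ‖y - xo‖ := by
  by_contra! hlt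
  have hden : 0 < ‖y‖ + 1 := by positivity
  -- Shrinking `y` towards the origin by `1 - t` stays in the ball and strictly lowers the
  -- objective; the `+ 1` guards against `y = 0`.
  set t : ℝ := min 1 ((lam - ‖y - xo‖) / (‖y‖ + 1)) with ht
  have ht0 : 0 < t := lt_min one_pos (div_pos (sub_pos.mpr hlt) hden)
  have ht1 : t ≤ 1 := min_le_left _ _
  have hty : t * ‖y‖ ≤ lam - ‖y - xo‖ := by
    have := (le_div_iff₀ hden).mp (min_le_right 1 ((lam - ‖y - xo‖) / (‖y‖ + 1)))
    rw [← ht] at this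
    linarith
  have hfeas : ‖(1 - t) • y - xo‖ ≤ lam := by
    have h := norm_sub_le (y - xo) (t • y)
    rw [norm_smul, Real.norm_of_nonneg ht0.le] at h
    rw [show (1 - t) • y - xo = y - xo - t • y by module]
    linarith
  have h := hx.2 _ hfeas
  rw [map_smul] at h
  have h' := nuclearNorm_smul_le (sub_nonneg.mpr ht1) (A y)
  nlinarith [nuclearNorm_nonneg (A y)]

/-- First-order optimality: moving from an optimal solution with positive value towards a point
that is at least as good does not decrease the distance to the centre of the ball. -/
theorem IsOptimalSolution.norm_sub_sq_le (hx : IsOptimalSolution A xo lam x) (hlam : 0 ≤ lam)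
    (hpos : 0 < nuclearNorm (A x)) {y : EuclideanSpace ℝ (Fin n)}
    (hy : nuclearNorm (A y) ≤ nuclearNorm (A x)) :
    ‖x - y‖ ^ 2 ≤ ‖y - xo‖ ^ 2 - lam ^ 2 := by
  have hxo : ‖x - xo‖ = lam := le_antisymm hx.1 (hx.le_norm_sub hpos le_rfl)
  -- By convexity the segment from `x` to `y` is no worse than `x`, so it avoids the open ball;
  -- expand the squared distance and divide by `t`.
  have hseg (t : ℝ) (ht0 : 0 < t) (ht1 : t ≤ 1) :
      0 ≤ 2 * inner ℝ (x - xo) (y - x) + t * ‖y - x‖ ^ 2 := by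
    have hle : nuclearNorm (A ((1 - t) • x + t • y)) ≤ nuclearNorm (A x) := by
      rw [map_add, map_smul, map_smul]
      have h0 := nuclearNorm_add_le ((1 - t) • A x) (t • A y)
      have h1 := nuclearNorm_smul_le (sub_nonneg.mpr ht1) (A x)
      have h2 := nuclearNorm_smul_le ht0.le (A y)
      have h3 := mul_le_mul_of_nonneg_left hy ht0.le
      linarith
    have h := pow_le_pow_left₀ hlam (hx.le_norm_sub hpos hle) 2
    rw [show (1 - t) • x + t • y - xo = (x - xo) + t • (y - x) by module, norm_add_sq_real,
      inner_smul_right, norm_smul, mul_pow, hxo, Real.norm_eq_abs, sq_abs] at h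
    refine nonneg_of_mul_nonneg_right (?_ : 0 ≤ t * _) ht0
    linarith
  have hinner : 0 ≤ 2 * inner ℝ (x - xo) (y - x) := by
    by_contra! hneg
    set c : ℝ := 2 * inner ℝ (x - xo) (y - x)
    have hden : 0 < ‖y - x‖ ^ 2 + 1 := by positivity
    -- This `t` keeps `t * ‖y - x‖ ^ 2` below `-c / 2`, standing in for the limit `t → 0`.
    have h := hseg (min 1 (-c / (2 * (‖y - x‖ ^ 2 + 1))))
      (lt_min one_pos (by apply div_pos <;> linarith)) (min_le_left _ _)
    have h' := (le_div_iff₀ (by positivity)).mp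
      (min_le_right 1 (-c / (2 * (‖y - x‖ ^ 2 + 1))))
    have h0 : 0 < min 1 (-c / (2 * (‖y - x‖ ^ 2 + 1))) :=
      lt_min one_pos (by apply div_pos <;> linarith)
    linarith
  have hdecomp := norm_add_sq_real (x - xo) (y - x)
  rw [show x - xo + (y - x) = y - xo by abel, hxo] at hdecomp
  rw [norm_sub_rev x y]
  linarith

end Optimality

theorem theorem2 {n p : ℕ} (hp : 2 ≤ p)
    (A : EuclideanSpace ℝ (Fin n) →ₗ[ℝ] Matrix (Fin p) (Fin p) ℝ) :
    (∃ CA : ℝ, IsNormEquivConst A CA) ∧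
    ∀ CA : ℝ, IsNormEquivConst A CA →
      ∀ (xo : EuclideanSpace ℝ (Fin n)) (lamStar lam : ℝ), 0 ≤ lamStar → lamStar ≤ lam →
      ∀ xStar xLam : EuclideanSpace ℝ (Fin n),
        IsOptimalSolution A xo lamStar xStar → IsOptimalSolution A xo lam xLam →
      ∀ imin : Fin p,
        (∀ i, singularVector (A xStar) imin ≤ singularVector (A xStar) i) →
        ∑ i, (singularVector (A xStar) i - singularVector (A xLam) i) ^ 2 ≤
          min
            (‖singularVector (A xStar) -
                nuclearNorm (A xStar) • EuclideanSpace.single imin (1 : ℝ)‖ ^ 2)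
            (CA * (lam ^ 2 - lamStar ^ 2)) := by
  refine ⟨exists_isNormEquivConst A, ?_⟩
  intro CA hCA xo lamStar lam hlamStar hle xStar xLam hStar hLam imin himin
  have hval : nuclearNorm (A xLam) ≤ nuclearNorm (A xStar) := hLam.2 _ (hStar.1.trans hle)
  refine le_min (sum_sq_sub_le_norm_sub_single_sq hp (singularVector_nonneg _)
    (singularVector_nonneg _) hval himin) ?_
  -- At optimal value zero `xStar` may be interior to the ball, but then both singular vectors
  -- vanish.
  rcases (nuclearNorm_nonneg (A xStar)).eq_or_lt with h0 | hpos
  · have hzero (M : Matrix (Fin p) (Fin p) ℝ) (hM : nuclearNorm M ≤ 0) (i : Fin p) :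
        singularVector M i = 0 :=
      (sum_eq_zero_iff_of_nonneg fun i _ => singularVector_nonneg M i).mp
        (hM.antisymm (nuclearNorm_nonneg M)) i (mem_univ i)
    simp only [hzero _ h0.ge, hzero _ (hval.trans h0.ge), sub_self, ne_eq, OfNat.ofNat_ne_zero,
      not_false_eq_true, zero_pow, sum_const_zero]
    exact mul_nonneg hCA.1 (sub_nonneg.mpr (pow_le_pow_left₀ hlamStar hle 2))
  · calc ∑ i, (singularVector (A xStar) i - singularVector (A xLam) i) ^ 2
        ≤ frobeniusNorm (A xStar - A xLam) ^ 2 := sum_sq_singularVector_sub_le _ _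
      _ ≤ CA * ‖xStar - xLam‖ ^ 2 := by
        rw [← map_sub]
        exact hCA.2 _
      _ ≤ CA * (lam ^ 2 - lamStar ^ 2) := by
        refine mul_le_mul_of_nonneg_left ?_ hCA.1
        have h1 := hStar.norm_sub_sq_le hlamStar hpos hval
        have h2 := pow_le_pow_left₀ (norm_nonneg _) hLam.1 2
        linarith
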